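/- **Setting.** Let $\Sigma$ be a finite non-empty alphabet, $I$ an irreflexive and symmetric relation on $\Sigma$, and $\mathcal M=\Sigma^*/(ab=ba,\ (a,b)\in I)$ the associated trace monoid, with length $|\cdot|$ and left divisibility order $x\le y\iff\exists z\ y=x\cdot z$. Cliques are the traces $a_1\cdots a_i$ ($i\ge 0$) with $a_1,\dots,a_i$ distinct and pairwise in $I$; $\mathscr C$ is the set of cliques and $\mathfrak C=\mathscr C\setminus\{1\}$. For cliques, $c\to c'$ means that for every letter $b$ of $c'$ there is a letter $a$ of $c$ with $(a,b)\notin I$. Let $\overline{\mathcal M}\supseteq\mathcal M$ be the completion of $(\mathcal M,\le)$ under least upper bounds of non-decreasing sequences, with its Lawson topology (generated by the sets $\{\xi\ge x\}$, $x\in\mathcal M$, and $\{\xi\not\ge\eta\}$, $\eta\in\overline{\mathcal M}$), and let $\partial\mathcal M=\overline{\mathcal M}\setminus\mathcal M$ be the boundary, with its Borel $\sigma$-algebra. For $x\in\mathcal M$ put $\uparrow x=\{\xi\in\partial\mathcal M: x\le\xi\}$. Every $\xi\in\partial\mathcal M$ has a unique decomposition $\xi=\bigvee_{i\ge1}C_1(\xi)\cdots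 C_i(\xi)$ with $C_i(\xi)\in\mathfrak C$ and $C_i(\xi)\to C_{i+1}(\xi)$ for all $i\ge1$; put $Y_i=C_1\cdots C_i$ and $Y_0=1$. Let $(\alpha,x)\mapsto\alpha\cdot x$ be a right action of $\mathcal M$ on a finite non-empty set $X$ (a total action). A *Markov measure* is a family $\mathbb P=(\mathbb P_\alpha)_{\alpha\in X}$ of probability measures on $\partial\mathcal M$ with $\mathbb P_\alpha(\uparrow(x\cdot y))=\mathbb P_\alpha(\uparrow x)\,\mathbb P_{\alpha\cdot x}(\uparrow y)$ for all $\alpha\in X$ and $x,y\in\mathcal M$. A *fibred valuation* is a family of functions $f_\alpha:\mathcal M\to\mathbb R$, $\alpha\in X$, with $f_\alpha(1)=1$ and $f_\alpha(x\cdot y)=f_\alpha(x)f_{\alpha\cdot x}(y)$. With the Möbius transforms $h_\alpha(c)=\sum_{c'\in\mathscr C,\ c'\ge c}(-1)^{|c'|-|c|}f_\alpha(c')$, $c\in\mathscr C$, it is *Möbius* if, for all $\alpha\in X$, $h_\alpha(1)=0$ and $h_\alpha(\gamma)\ge0$ for all $\gamma\in\mathfrak C$. **Theorem 1.** Let $\mathbb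 P=(\mathbb P_\alpha)_{\alpha\in X}$ be a Markov measure for such a total action, let $f_\alpha(x)=\mathbb P_\alpha(\uparrow x)$, and let $h_\alpha$ be the Möbius transform of $f_\alpha$. Then: 1. $(f_\alpha)_{\alpha\in X}$ is a Möbius fibred valuation. 2. For every $\alpha_0\in X$, under $\mathbb P_{\alpha_0}$, the sequence $(\alpha_0\cdot Y_{i-1},\,C_i)_{i\ge1}$ is a homogeneous Markov chain with values in $X\times\mathfrak C$. 3. The initial law of this chain is $\delta_{\{\alpha_0\}}\otimes(h_{\alpha_0}|_{\mathfrak C})$. 4. The transition matrix of this chain does not depend on $\alpha_0$ and is given by $$P_{(\alpha,\gamma),(\alpha',\gamma')}=\mathbf 1_{\{\alpha'=\alpha\cdot\gamma\}}\,\mathbf 1_{\{\gamma\to\gamma'\}}\,\frac{h_{\alpha'}(\gamma')}{g_{\alpha'}(\gamma)},\qquad g_{\alpha'}(\gamma)=\sum_{\gamma''\in\mathfrak C:\ \gamma\to\gamma''}h_{\alpha'}(\gamma''),$$ where the functions $g_{\alpha'}:\mathfrak C\to\mathbb R$ are non-negative, and the entry is replaced by $0$ if $g_{\alpha'}(\gamma)=0$.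 (The rows that are thereby entirely zero are indexed by states which the chain visits with probability $0$; all rows indexed by states visited with positive probability sum to $1$.) -/

import Mathlib

open MeasureTheory
open scoped RightActions

noncomputable section

/-! ## Trace monoids -/

section TraceMonoid

variable {A : Type*}

/-- The congruence on the free monoid `A*` generated by the pairs `(ab, ba)`, for `a` and `b`
independent. An independence relation on `A` (an irreflexive and symmetric relation) is the
adjacency relation of a simple graph `G`. -/
def traceCon (G : SimpleGraph A) : Con (FreeMonoid A) :=
  conGen fun u v => ∃ a b : A, G.Adj a b ∧
    u = FreeMonoid.of a * FreeMonoid.of b ∧ v = FreeMonoid.of b * FreeMonoid.of a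

/-- The trace monoid `M(A, I)`, the quotient of `A*` by the commutation of independent letters. -/
def TraceMonoid (G : SimpleGraph A) : Type _ := (traceCon G).Quotient

namespace TraceMonoid

variable {G : SimpleGraph A}

instance : Monoid (TraceMonoid G) := inferInstanceAs (Monoid (traceCon G).Quotient)

/-- A letter, seen as a trace. -/
def letter (a : A) : TraceMonoid G := (traceCon G).mk' (FreeMonoid.of a)

theorem letter_mul_letter_comm {a b : A} (h : G.Adj a b) :
    (letter a * letter b : TraceMonoid G) = letter b * letter a :=
  (Con.eq (traceCon G)).2 (ConGen.Rel.of _ _ ⟨a, b, h, rfl, rfl⟩)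

/-- The length of traces, as a monoid homomorphism: the length of any representative word. -/
def lengthHom : TraceMonoid G →* Multiplicative ℕ :=
  (traceCon G).lift (FreeMonoid.lift fun _ => Multiplicative.ofAdd 1) <|
    Con.conGen_le.2 <| by
      rintro _ _ ⟨a, b, -, rfl, rfl⟩
      simp only [Con.ker_rel, map_mul, FreeMonoid.lift_eval_of]

/-- The length `|x|` of a trace. -/
def length (x : TraceMonoid G) : ℕ := (lengthHom x).toAdd

/-- Left divisibility: `x ≤ y` iff `y = x * z` for some `z`. -/
instance : Preorder (TraceMonoid G) where
  le x y := ∃ z, y = x * z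
  le_refl x := ⟨1, (mul_one x).symm⟩
  le_trans := by
    rintro x _ _ ⟨u, rfl⟩ ⟨v, rfl⟩
    exact ⟨u * v, mul_assoc x u v⟩

end TraceMonoid

/-! ## Cliques -/

/-- Cliques of the trace monoid, seen as the sets of pairwise independent letters. -/
def TraceClique (G : SimpleGraph A) : Type _ := {s : Finset A // G.IsClique (s : Set A)}

namespace TraceClique

variable {G : SimpleGraph A}

instance [Finite A] : Finite (TraceClique G) :=
  inferInstanceAs (Finite {s : Finset A // G.IsClique (s : Set A)})

instance [Finite A] : Fintype (TraceClique G) := Fintype.ofFinite _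

/-- The set of letters of a clique. -/
def letters (c : TraceClique G) : Finset A := c.1

/-- The trace `a₁ ⋯ aᵢ` of a clique with letters `a₁, …, aᵢ`. -/
def toTrace (c : TraceClique G) : TraceMonoid G :=
  c.letters.noncommProd TraceMonoid.letter fun _ ha _ hb hab =>
    TraceMonoid.letter_mul_letter_comm (c.2 ha hb hab)

/-- The empty clique, whose trace is `1`. -/
def empty : TraceClique G := ⟨∅, by simp⟩

/-- The Cartier-Foata relation `c → c'`: every letter of `c'` is dependent of some letter
of `c`. -/
def Foata (c c' : TraceClique G) : Prop :=
  ∀ b ∈ c'.letters, ∃ a ∈ c.letters, ¬ G.Adj a b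

end TraceClique

/-- Non-empty cliques. -/
def NTraceClique (G : SimpleGraph A) : Type _ := {c : TraceClique G // c ≠ TraceClique.empty}

namespace NTraceClique

variable {G : SimpleGraph A}

instance [Finite A] : Finite (NTraceClique G) :=
  inferInstanceAs (Finite {c : TraceClique G // c ≠ TraceClique.empty})

instance [Finite A] : Fintype (NTraceClique G) := Fintype.ofFinite _

/-- The clique underlying a non-empty clique. -/
def toClique (c : NTraceClique G) : TraceClique G := c.1

/-- The trace of a non-empty clique. -/
def toTrace (c : NTraceClique G) : TraceMonoid G := c.toClique.toTrace

instance [Nonempty A] : Nonempty (NTraceClique G) :=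
  ⟨⟨⟨{Classical.arbitrary A}, by simp⟩, fun h =>
    Finset.singleton_ne_empty _ (congrArg Subtype.val h)⟩⟩

end NTraceClique

/-! ## The Möbius transform -/

open Classical in
/-- The Möbius transform of `f`, at the clique `c`: the sum of `(-1)^(|c'|-|c|) f(c')` over the
cliques `c' ≥ c`. It only depends on the restriction of `f` to cliques. -/
def mobiusTransform {G : SimpleGraph A} [Finite A] (f : TraceMonoid G → ℝ)
    (c : TraceClique G) : ℝ :=
  ∑ c' : TraceClique G with c.toTrace ≤ c'.toTrace,
    (-1 : ℝ) ^ (c'.toTrace.length - c.toTrace.length) * f c'.toTrace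

/-! ## Generalised traces and the boundary at infinity -/

/-- Generalised traces: the completion of `(M, ≤)` under least upper bounds of non-decreasing
sequences, realised as the set of (non-empty, directed, lower) ideals of `M` ordered by inclusion.
As `M` is countable, such an ideal is exactly the set of traces below some term of a non-decreasing
sequence of traces. -/
abbrev GenTrace (G : SimpleGraph A) : Type _ := Order.Ideal (TraceMonoid G)

/-- The canonical embedding of traces in generalised traces. -/
def TraceMonoid.toGen {G : SimpleGraph A} (x : TraceMonoid G) : GenTrace G :=
  Order.Ideal.principal x

/-- The Lawson topology on generalised traces. It is the join of the Scott topology, generated by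
the full elementary cylinders, and of the lower topology, generated by the complements of
principal upper sets. -/
instance GenTrace.instTopologicalSpace (G : SimpleGraph A) : TopologicalSpace (GenTrace G) :=
  TopologicalSpace.generateFrom
    (Set.range (fun x : TraceMonoid G => Set.Ici x.toGen) ∪
      Set.range (fun ξ : GenTrace G => (Set.Ici ξ)ᶜ))

instance GenTrace.instMeasurableSpace (G : SimpleGraph A) : MeasurableSpace (GenTrace G) :=
  borel (GenTrace G)

instance GenTrace.instBorelSpace (G : SimpleGraph A) : BorelSpace (GenTrace G) := ⟨rfl⟩

/-- The boundary at infinity: the infinite traces, that is, the generalised traces that are not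
traces. It carries the restricted topology and its Borel σ-algebra. -/
abbrev TraceBoundary (G : SimpleGraph A) : Type _ :=
  {ξ : GenTrace G // ξ ∉ Set.range (TraceMonoid.toGen (G := G))}

variable {G : SimpleGraph A}

/-- The elementary cylinder `↑x`, the set of infinite traces `ξ` with `x ≤ ξ`. -/
def elemCylinder (x : TraceMonoid G) : Set (TraceBoundary G) := {ξ | x.toGen ≤ ξ.1}

/-- The product `c₀ ⋯ cₙ₋₁` of the first `n` terms of a sequence of non-empty cliques. -/
def foataProd (c : ℕ → NTraceClique G) (n : ℕ) : TraceMonoid G :=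
  ((List.range n).map fun i => (c i).toTrace).prod

/-- The sequence `c` is the extended Cartier-Foata decomposition of the infinite trace `ξ`. -/
structure IsFoataDecomp (ξ : TraceBoundary G) (c : ℕ → NTraceClique G) : Prop where
  foata : ∀ i, (c i).toClique.Foata (c (i + 1)).toClique
  isLUB : IsLUB (Set.range fun n => (foataProd c n).toGen) ξ.1

/-- The clique `Cᵢ₊₁(ξ)`: the sequence `i ↦ foataClique i ξ` is the extended Cartier-Foata
decomposition of `ξ`. Such a decomposition exists and is unique. -/
def foataClique [Nonempty A] (i : ℕ) (ξ : TraceBoundary G) : NTraceClique G :=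
  Classical.epsilon (IsFoataDecomp ξ) i

/-- The trace `Yₙ(ξ) = C₁(ξ) ⋯ Cₙ(ξ)`. -/
def foataTrace [Nonempty A] (n : ℕ) (ξ : TraceBoundary G) : TraceMonoid G :=
  foataProd (fun i => foataClique i ξ) n

/-! ## Markov measures and fibred valuations

A right action of the trace monoid on `X` is an action of the opposite monoid; it is written
`α <• x`. -/

variable {X : Type*}

/-- The fibred valuation `f_α(x) = P_α(↑x)`. -/
def markovValuation (P : X → Measure (TraceBoundary G)) (α : X) (x : TraceMonoid G) : ℝ :=
  (P α).real (elemCylinder x)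

open Classical in
/-- The function `g_α(γ)`, the sum of `h_α(γ')` over the non-empty cliques `γ'` with `γ → γ'`,
where `h_α` is the Möbius transform of `f_α`. -/
def foataSum [Finite A] (f : X → TraceMonoid G → ℝ) (α : X) (γ : NTraceClique G) : ℝ :=
  ∑ γ' : NTraceClique G with γ.toClique.Foata γ'.toClique, mobiusTransform (f α) γ'.toClique

open Classical in
/-- The weights of the product of the Dirac mass at `α₀` with the law on non-empty cliques given
by the Möbius transform of `f_{α₀}`. -/
def initialLaw [Finite A] (f : X → TraceMonoid G → ℝ) (α₀ : X) (p : X × NTraceClique G) : ℝ :=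
  (if p.1 = α₀ then 1 else 0) * mobiusTransform (f α₀) p.2.toClique

variable [MulAction (TraceMonoid G)ᵐᵒᵖ X]

/-- A Markov measure: a family of probability measures on the boundary that satisfies the chain
rule `P_α(↑(x * y)) = P_α(↑x) P_{α·x}(↑y)`. -/
structure IsMarkovMeasure (P : X → Measure (TraceBoundary G)) : Prop where
  isProbabilityMeasure : ∀ α, IsProbabilityMeasure (P α)
  chain : ∀ α x y, P α (elemCylinder (x * y)) =
    P α (elemCylinder x) * P (α <• x) (elemCylinder y)

/-- A fibred valuation. -/
structure IsFibredValuation (f : X → TraceMonoid G → ℝ) : Prop where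
  one : ∀ α, f α 1 = 1
  mul : ∀ α x y, f α (x * y) = f α x * f (α <• x) y

/-- A Möbius fibred valuation. -/
structure IsMobiusFibredValuation [Finite A] (f : X → TraceMonoid G → ℝ) : Prop
    extends IsFibredValuation f where
  mobius_one : ∀ α, mobiusTransform (f α) TraceClique.empty = 0
  mobius_nonneg : ∀ α (c : NTraceClique G), 0 ≤ mobiusTransform (f α) c.toClique

open Classical in
/-- The matrix `h_{α'}(γ') / g_{α'}(γ)` restricted to `α' = α·γ` and `γ → γ'`, and `0` where
`g_{α'}(γ) = 0`. -/
def transitionMatrix [Finite A] (f : X → TraceMonoid G → ℝ) (p q : X × NTraceClique G) : ℝ :=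
  if foataSum f q.1 p.2 = 0 then 0
  else if q.1 = p.1 <• p.2.toTrace ∧ p.2.toClique.Foata q.2.toClique then
    mobiusTransform (f q.1) q.2.toClique / foataSum f q.1 p.2
  else 0

/-- The process of states-and-cliques: at time `n` it is `(α₀·Yₙ, Cₙ₊₁)`. -/
def stateClique [Nonempty A] (α₀ : X) (n : ℕ) (ξ : TraceBoundary G) : X × NTraceClique G :=
  (α₀ <• foataTrace n ξ, foataClique n ξ)

end TraceMonoid

/-! ## Markov chains -/

/-- Under `μ`, the sequence `Z` of random variables with values in the countable set `E` is a
homogeneous Markov chain with initial law `ν` and transition matrix `K`. The one-step rule says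
that the conditional probability of `Z (n + 1) = z (n + 1)` given `Z 0 = z 0, …, Z n = z n` is
`K (z n) (z (n + 1))` as soon as it is defined. The rows of `K` are required to sum to `1` only
at the states that are reached with positive probability. -/
structure IsHomogeneousMarkovChain {Ω E : Type*} [MeasurableSpace Ω] [Countable E]
    (μ : Measure Ω) (Z : ℕ → Ω → E) (ν : E → ℝ) (K : E → E → ℝ) : Prop where
  measurable : ∀ n e, MeasurableSet (Z n ⁻¹' {e})
  init : ∀ e, μ.real (Z 0 ⁻¹' {e}) = ν e
  nonneg : ∀ e e', 0 ≤ K e e'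
  hasSum : ∀ n e, μ (Z n ⁻¹' {e}) ≠ 0 → HasSum (K e) 1
  step : ∀ (n : ℕ) (z : ℕ → E), μ.real {ω | ∀ i ≤ n + 1, Z i ω = z i} =
    μ.real {ω | ∀ i ≤ n, Z i ω = z i} * K (z n) (z (n + 1))

end

/-! ## Divisibility in trace monoids -/

namespace TraceMonoid

variable {A : Type*} {G : SimpleGraph A}

/-! The decomposition of an infinite trace `ξ` is greedy: `C_{n+1}(ξ)` is the largest clique `c`
with `Y_n · c ≤ ξ` (`isFoataDecomp_iff`). The relation `→` between consecutive cliques makes the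
past recoverable: if `c_1 → ⋯ → c_n`, then `C_1 = c_1, …, C_n = c_n` holds as soon as `ξ ≥ x = c_1 ⋯
c_{n-1}` and the top clique of `ξ` after `x` is `c_n` (`setOf_foataClique_eq`). Finite-dimensional
laws of the chain thus reduce to the probability of `cliqueEvent x c`, which is computed in two
ways.

By top clique: the cylinder of `x · c` is the disjoint union of the `cliqueEvent x e` for `e ⊇ c`.
Möbius inversion and the chain rule give `f_α(x) h_{α·x}(c)`. For `x = 1` this shows `h_α ≥ 0`, and
`h_α(1) = 0` because a boundary point always has a next letter.

By next clique: `cliqueEvent x c` is the disjoint union of the `cliqueEvent (x · c) d` for `c → d`,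
whence `f_α(x · c) g_{α·x·c}(c)`.

The quotient of the two expressions at consecutive times is `h / g`, the transition matrix. All this
rests on Levi's lemma, obtained from an explicit left division by a letter. -/

theorem inductionOn {p : TraceMonoid G → Prop} (x : TraceMonoid G) (one : p 1)
    (letter_mul : ∀ a x, p x → p (letter a * x)) : p x := by
  refine Con.induction_on (c := traceCon G) x fun w => ?_
  induction w using FreeMonoid.inductionOn' with
  | one => exact one
  | of_mul a w ih => exact letter_mul a _ ih

instance [Finite A] : Countable (TraceMonoid G) :=
  have : Countable (FreeMonoid A) := inferInstanceAs (Countable (List A))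
  inferInstanceAs (Countable (Quotient (traceCon G).toSetoid))

/-- The monoid homomorphism that extends a map from letters which sends independent letters to
commuting elements. -/
def lift {M : Type*} [Monoid M] (f : A → M) (hf : ∀ a b, G.Adj a b → f a * f b = f b * f a) :
    TraceMonoid G →* M :=
  (traceCon G).lift (FreeMonoid.lift f) <| Con.conGen_le.2 <| by
    rintro _ _ ⟨a, b, hab, rfl, rfl⟩
    simpa only [Con.ker_rel, map_mul, FreeMonoid.lift_eval_of] using hf a b hab

open Classical in
/-- The quotient of `letter b * x` by the letter `a` on the left, if it exists, in terms of the
quotient `o` of `x` by `a`. -/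
noncomputable def divStep (a b : A) (x : TraceMonoid G) (o : Option (TraceMonoid G)) :
    Option (TraceMonoid G) :=
  if a = b then some x else if G.Adj a b then o.map (letter b * ·) else none

/-- A trace acting on pairs formed by a trace and its quotient by the letter `a` on the left. -/
noncomputable def divHom (a : A) :
    TraceMonoid G →* Function.End (TraceMonoid G × Option (TraceMonoid G)) :=
  -- The trace is carried along with its quotient because dividing `b · x` by `a = b` returns `x`.
  -- Division is well defined on traces since these operators commute for independent letters.
  lift (fun b p => (letter b * p.1, divStep a b p.1 p.2)) <| by
    intro b c hbc
    have hne := hbc.ne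
    funext ⟨x, o⟩
    have hcomm : (letter b * (letter c * x) : TraceMonoid G) = letter c * (letter b * x) := by
      rw [← mul_assoc, letter_mul_letter_comm hbc, mul_assoc]
    refine Prod.ext hcomm ?_
    change divStep a b (letter c * x) (divStep a c x o) =
      divStep a c (letter b * x) (divStep a b x o)
    unfold divStep
    by_cases hb : a = b
    · subst hb
      simp [hne, hbc]
    · by_cases hc : a = c
      · subst hc
        simp [hne.symm, hbc.symm]
      · cases o with
        | none => simp [hb, hc]
        | some y =>
          have hcomm' : (letter b * (letter c * y) : TraceMonoid G) = letter c * (letter b * y) := by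
            rw [← mul_assoc, letter_mul_letter_comm hbc, mul_assoc]
          by_cases h1 : G.Adj a b <;> by_cases h2 : G.Adj a c <;> simp [hb, hc, h1, h2, hcomm']

/-- The quotient of a trace by a letter on the left, if it exists. -/
noncomputable def letterDiv (a : A) (x : TraceMonoid G) : Option (TraceMonoid G) :=
  (divHom a x (1, none)).2

theorem divHom_fst (a : A) (x : TraceMonoid G) : (divHom a x (1, none)).1 = x := by
  induction x using inductionOn with
  | one => rw [map_one]; rfl
  | letter_mul b x ih =>
    rw [map_mul]
    exact congrArg (letter b * ·) ih

theorem letterDiv_one (a : A) : letterDiv a (1 : TraceMonoid G) = none := by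
  rw [letterDiv, map_one]; rfl

theorem letterDiv_letter_mul (a b : A) (x : TraceMonoid G) :
    letterDiv a (letter b * x) = divStep a b x (letterDiv a x) := by
  rw [letterDiv, map_mul]
  change divStep a b (divHom a x (1, none)).1 (divHom a x (1, none)).2 = _
  rw [divHom_fst, letterDiv]

theorem letterDiv_letter_mul_self (a : A) (x : TraceMonoid G) :
    letterDiv a (letter a * x) = some x := by
  simp [letterDiv_letter_mul, divStep]

theorem eq_letter_mul_of_letterDiv {a : A} {x y : TraceMonoid G} (h : letterDiv a x = some y) :
    x = letter a * y := by
  induction x using inductionOn generalizing y with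
  | one => simp [letterDiv_one] at h
  | letter_mul b x ih =>
    rw [letterDiv_letter_mul, divStep] at h
    split_ifs at h with h1 h2
    · subst h1
      rw [Option.some.inj h]
    · obtain ⟨z, hz, rfl⟩ := Option.map_eq_some_iff.1 h
      rw [ih hz, ← mul_assoc, letter_mul_letter_comm h2.symm, mul_assoc]

/-- Levi's lemma, for two letters. -/
theorem letter_mul_eq_letter_mul {a b : A} {x y : TraceMonoid G}
    (h : letter a * x = letter b * y) :
    a = b ∧ x = y ∨ G.Adj a b ∧ ∃ z, x = letter b * z ∧ y = letter a * z := by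
  -- Dividing both sides by `a` leaves `x` on the left; the branches of `divStep` on the right are
  -- the cases of the lemma, `none` being impossible.
  have h' := congrArg (letterDiv a) h
  rw [letterDiv_letter_mul_self, letterDiv_letter_mul, divStep] at h'
  split_ifs at h' with h1 h2
  · exact .inl ⟨h1, Option.some.inj h'⟩
  · obtain ⟨z, hz, hz'⟩ := Option.map_eq_some_iff.1 h'.symm
    exact .inr ⟨h2, z, hz'.symm, eq_letter_mul_of_letterDiv hz⟩

instance : IsLeftCancelMul (TraceMonoid G) where
  mul_left_cancel x y z h := by
    induction x using inductionOn with
    | one => simpa using h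
    | letter_mul a x ih =>
      refine ih ?_
      simp only [mul_assoc] at h
      rcases letter_mul_eq_letter_mul h with h | h
      · exact h.2
      · exact absurd h.1 (G.loopless.irrefl a)

theorem le_mul_right_self (x y : TraceMonoid G) : x ≤ x * y := ⟨y, rfl⟩

theorem one_le' (x : TraceMonoid G) : 1 ≤ x := ⟨x, (one_mul x).symm⟩

theorem mul_le_mul_left_iff {x y z : TraceMonoid G} : x * y ≤ x * z ↔ y ≤ z := by
  constructor
  · rintro ⟨u, hu⟩
    exact ⟨u, mul_left_cancel (hu.trans (mul_assoc x y u))⟩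
  · rintro ⟨u, rfl⟩
    exact ⟨u, (mul_assoc x y u).symm⟩

theorem length_one : (1 : TraceMonoid G).length = 0 := by
  simp [length]

theorem length_mul (x y : TraceMonoid G) : (x * y).length = x.length + y.length := by
  simp [length]

theorem length_letter (a : A) : (letter a : TraceMonoid G).length = 1 := rfl

theorem not_letter_le_one (a : A) : ¬ (letter a : TraceMonoid G) ≤ 1 := by
  rintro ⟨z, hz⟩
  have := congrArg length hz
  rw [length_mul, length_letter, length_one] at this
  omega

theorem exists_letter_le {x : TraceMonoid G} (hx : x ≠ 1) : ∃ a, letter a ≤ x := by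
  induction x using inductionOn with
  | one => exact absurd rfl hx
  | letter_mul a x _ => exact ⟨a, x, rfl⟩

theorem letter_le_letter_mul_iff {a b : A} {x : TraceMonoid G} :
    letter b ≤ letter a * x ↔ b = a ∨ G.Adj a b ∧ letter b ≤ x := by
  constructor
  · rintro ⟨y, hy⟩
    rcases letter_mul_eq_letter_mul hy with ⟨h, -⟩ | ⟨h, z, hz, -⟩
    · exact .inl h.symm
    · exact .inr ⟨h, z, hz⟩
  · rintro (rfl | ⟨h, z, rfl⟩)
    · exact ⟨x, rfl⟩
    · exact ⟨letter a * z, by rw [← mul_assoc, letter_mul_letter_comm h, mul_assoc]⟩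

/-- The least upper bound of a trace and of a letter that have a common upper bound. -/
theorem letter_le_or_commute {b : A} {w v : TraceMonoid G} (hb : letter b ≤ v) (hw : w ≤ v) :
    letter b ≤ w ∨ letter b * w = w * letter b ∧ w * letter b ≤ v := by
  induction w using inductionOn generalizing v with
  | one => exact .inr ⟨by simp, by simpa using hb⟩
  | letter_mul a w ih =>
    obtain ⟨z, rfl⟩ := hw
    rw [mul_assoc] at hb
    rcases letter_le_letter_mul_iff.1 hb with rfl | ⟨hab, hb'⟩
    · exact .inl (le_mul_right_self _ _)
    · rcases ih hb' (le_mul_right_self w z) with h | ⟨h, h'⟩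
      · exact .inl (letter_le_letter_mul_iff.2 (.inr ⟨hab, h⟩))
      · refine .inr ⟨?_, ?_⟩
        · rw [← mul_assoc, ← letter_mul_letter_comm hab, mul_assoc, h, mul_assoc]
        · rw [mul_assoc, mul_assoc]
          exact mul_le_mul_left_iff.2 h'

end TraceMonoid

namespace TraceClique

open TraceMonoid

variable {A : Type*} {G : SimpleGraph A}

theorem ext {c d : TraceClique G} (h : ∀ a, a ∈ c.letters ↔ a ∈ d.letters) : c = d :=
  Subtype.ext (Finset.ext h)

theorem notMem_empty (a : A) : a ∉ (empty : TraceClique G).letters := Finset.notMem_empty a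

theorem toTrace_empty : (empty : TraceClique G).toTrace = 1 := Finset.noncommProd_empty _ _

/-- Describing the larger clique `d` by membership, instead of as an insertion, keeps decidable
equality out of the statement. -/
theorem induction {p : TraceClique G → Prop} (c : TraceClique G) (empty : p empty)
    (insert : ∀ (a : A) (c d : TraceClique G), a ∉ c.letters → (∀ b ∈ c.letters, G.Adj a b) →
      (∀ b, b ∈ d.letters ↔ b = a ∨ b ∈ c.letters) → d.toTrace = letter a * c.toTrace →
      p c → p d) : p c := by
  classical
  obtain ⟨s, hs⟩ := c
  induction s using Finset.induction_on with
  | empty => exact empty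
  | insert a s ha ih =>
    have hs' : G.IsClique (s : Set A) := hs.subset (by simp)
    refine insert a ⟨s, hs'⟩ _ ha (fun b hb => ?_) (fun b => Finset.mem_insert) ?_ (ih hs')
    · exact hs (by simp) (Finset.mem_coe.2 (Finset.mem_insert_of_mem hb))
        (fun h => ha (h ▸ hb))
    · exact Finset.noncommProd_insert_of_notMem _ _ _ _ ha

theorem letter_le_toTrace_mul_iff {b : A} {c : TraceClique G} {y : TraceMonoid G} :
    letter b ≤ c.toTrace * y ↔
      b ∈ c.letters ∨ (∀ a ∈ c.letters, G.Adj a b) ∧ letter b ≤ y := by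
  induction c using TraceClique.induction with
  | empty => simp [toTrace_empty, notMem_empty]
  | insert a c d ha hadj hd hdt ih =>
    rw [hdt, mul_assoc, letter_le_letter_mul_iff, ih]
    simp only [hd]
    constructor
    · rintro (h | ⟨h, h' | h'⟩)
      · exact .inl (.inl h)
      · exact .inl (.inr h')
      · refine .inr ⟨?_, h'.2⟩
        rintro _ (rfl | hx)
        exacts [h, h'.1 _ hx]
    · rintro ((h | h) | ⟨h, h'⟩)
      · exact .inl h
      · exact .inr ⟨hadj b h, .inl h⟩
      · exact .inr ⟨h a (.inl rfl), .inr ⟨fun x hx => h x (.inr hx), h'⟩⟩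

theorem letter_le_toTrace_iff {b : A} {c : TraceClique G} :
    letter b ≤ c.toTrace ↔ b ∈ c.letters := by
  rw [← mul_one c.toTrace, letter_le_toTrace_mul_iff]
  simp [not_letter_le_one]

/-- A clique is the least upper bound of its letters: once one letter is divided out of `v`, Levi's
lemma keeps the others below the quotient. -/
theorem toTrace_le_iff {c : TraceClique G} {v : TraceMonoid G} :
    c.toTrace ≤ v ↔ ∀ a ∈ c.letters, letter a ≤ v := by
  refine ⟨fun h a ha => (letter_le_toTrace_iff.2 ha).trans h, ?_⟩
  induction c using TraceClique.induction generalizing v with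
  | empty => exact fun _ => toTrace_empty (G := G) ▸ one_le' v
  | insert a c d ha hadj hd hdt ih =>
    intro h
    obtain ⟨u, rfl⟩ := h a ((hd a).2 (.inl rfl))
    rw [hdt, mul_le_mul_left_iff]
    refine ih fun b hb => ?_
    rcases letter_le_letter_mul_iff.1 (h b ((hd b).2 (.inr hb))) with rfl | h'
    exacts [absurd hb ha, h'.2]

theorem toTrace_le_toTrace_iff {c d : TraceClique G} :
    c.toTrace ≤ d.toTrace ↔ c.letters ⊆ d.letters := by
  simp only [toTrace_le_iff, letter_le_toTrace_iff]
  rfl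

theorem length_toTrace (c : TraceClique G) : c.toTrace.length = c.letters.card := by
  classical
  induction c using TraceClique.induction with
  | empty => rw [toTrace_empty, TraceMonoid.length_one]; rfl
  | insert a c d ha hadj hd hdt ih =>
    have : d.letters = insert a c.letters := by ext b; simp [hd]
    rw [hdt, length_mul, length_letter, ih, this, Finset.card_insert_of_notMem ha, add_comm]

theorem letter_mul_toTrace_comm {b : A} {c : TraceClique G} (h : ∀ a ∈ c.letters, G.Adj a b) :
    letter b * c.toTrace = c.toTrace * letter b := by
  induction c using TraceClique.induction with
  | empty => simp [toTrace_empty]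
  | insert a c d ha hadj hd hdt ih =>
    rw [hdt, ← mul_assoc, ← letter_mul_letter_comm (h a ((hd a).2 (.inl rfl))), mul_assoc,
      ih fun x hx => h x ((hd x).2 (.inr hx)), mul_assoc]

/-- A common upper bound of a trace `w` and of a clique `c`, below a given one, whose quotient by
`c` is not longer than `w`. -/
theorem exists_le_toTrace_mul {c : TraceClique G} {w v : TraceMonoid G} (hc : c.toTrace ≤ v)
    (hw : w ≤ v) : ∃ u, w ≤ c.toTrace * u ∧ c.toTrace * u ≤ v ∧ u.length ≤ w.length ∧
      ∀ a ∈ c.letters, letter a ≤ w → u.length < w.length := by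
  induction c using TraceClique.induction generalizing v w with
  | empty =>
    exact ⟨w, by simp [toTrace_empty], by simpa [toTrace_empty] using hw, le_rfl,
      fun a ha => absurd ha (notMem_empty a)⟩
  | insert a c d ha hadj hd hdt ih =>
    have hav : letter a ≤ v := (le_mul_right_self _ _).trans (hdt ▸ hc)
    obtain ⟨v', rfl⟩ := hav
    rw [hdt, mul_le_mul_left_iff] at hc
    -- If `a` divides `w`, passing to the quotient gains one unit of length. Otherwise `a` commutes
    -- with `w`, so `w` itself lies below `v'`.
    by_cases haw : letter a ≤ w
    · obtain ⟨w', rfl⟩ := haw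
      rw [mul_le_mul_left_iff] at hw
      obtain ⟨u, h1, h2, h3, -⟩ := ih hc hw
      have hlt : u.length < (letter a * w').length := by
        rw [length_mul, length_letter]; omega
      refine ⟨u, ?_, ?_, hlt.le, fun _ _ _ => hlt⟩ <;>
        rwa [hdt, mul_assoc, mul_le_mul_left_iff]
    · obtain ⟨hcomm, hle⟩ := (letter_le_or_commute (le_mul_right_self _ _) hw).resolve_left haw
      rw [← hcomm, mul_le_mul_left_iff] at hle
      obtain ⟨u, h1, h2, h3, h4⟩ := ih hc hle
      refine ⟨u, ?_, ?_, h3, fun b hb hbw => ?_⟩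
      · rw [hdt, mul_assoc]
        refine (le_mul_right_self w (letter a)).trans ?_
        rwa [← hcomm, mul_le_mul_left_iff]
      · rwa [hdt, mul_assoc, mul_le_mul_left_iff]
      · rcases (hd b).1 hb with rfl | hb
        exacts [absurd hbw haw, h4 b hb hbw]

end TraceClique

/-! ## Cartier-Foata decompositions -/

section Foata

open TraceMonoid TraceClique

variable {A : Type*} {G : SimpleGraph A}

/-- Directedness provides a common upper bound in `ξ`, to which Levi's lemma applies after
cancelling `x`. -/
theorem GenTrace.mul_letter_mul_letter_mem {ξ : GenTrace G} {x : TraceMonoid G} {a b : A}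
    (ha : x * letter a ∈ ξ) (hb : x * letter b ∈ ξ) (hab : a ≠ b) :
    G.Adj a b ∧ x * letter a * letter b ∈ ξ := by
  obtain ⟨_, hv, ⟨u, rfl⟩, h⟩ := ξ.directed _ ha _ hb
  change x * letter b ≤ x * letter a * u at h
  rw [mul_assoc, mul_le_mul_left_iff] at h
  rcases letter_le_letter_mul_iff.1 h with h | ⟨h, h'⟩
  · exact absurd h.symm hab
  · exact ⟨h, ξ.lower (mul_le_mul_left_iff.2 h') hv⟩

theorem foataProd_zero (c : ℕ → NTraceClique G) : foataProd c 0 = 1 := rfl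

theorem foataProd_succ (c : ℕ → NTraceClique G) (n : ℕ) :
    foataProd c (n + 1) = foataProd c n * (c n).toClique.toTrace := by
  simp [foataProd, List.range_succ, NTraceClique.toTrace]

theorem foataProd_congr {c d : ℕ → NTraceClique G} {n : ℕ} (h : ∀ i < n, c i = d i) :
    foataProd c n = foataProd d n := by
  unfold foataProd
  congr 1
  exact List.map_congr_left fun i hi => by rw [h i (List.mem_range.1 hi)]

theorem foataProd_add (c : ℕ → NTraceClique G) (m n : ℕ) :
    foataProd c (m + n) = foataProd c m * foataProd (fun i => c (m + i)) n := by
  induction n with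
  | zero => simp [foataProd_zero]
  | succ n ih => rw [← add_assoc, foataProd_succ, foataProd_succ, ih, mul_assoc]

theorem foataProd_monotone (c : ℕ → NTraceClique G) : Monotone (foataProd c) :=
  monotone_nat_of_le_succ fun n => foataProd_succ c n ▸ le_mul_right_self _ _

/-- A letter outside `c 0` would be independent of `c 0` and divide the remaining product. By
induction it would belong to `c 1`, against `c 0 → c 1`. -/
theorem mem_letters_of_letter_le_foataProd {c : ℕ → NTraceClique G} {n : ℕ} {b : A}
    (hc : ∀ i, (c i).toClique.Foata (c (i + 1)).toClique) (h : letter b ≤ foataProd c n) :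
    b ∈ (c 0).toClique.letters := by
  induction n generalizing c with
  | zero => exact absurd h (not_letter_le_one b)
  | succ n ih =>
    rw [add_comm, foataProd_add, foataProd_succ, foataProd_zero, one_mul,
      letter_le_toTrace_mul_iff] at h
    refine h.resolve_right fun ⟨h1, h2⟩ => ?_
    obtain ⟨a, ha, hab⟩ := hc 0 b (ih (fun i => hc (1 + i)) h2)
    exact hab (h1 a ha)

/-- The generalised trace that is the least upper bound of the partial products. -/
def foataLimit (c : ℕ → NTraceClique G) : GenTrace G :=
  Order.IsIdeal.toIdeal (I := {x | ∃ n, x ≤ foataProd c n})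
    { IsLowerSet := fun _ _ hyx ⟨n, hn⟩ => ⟨n, hyx.trans hn⟩
      Nonempty := ⟨1, 0, le_rfl⟩
      Directed := fun _ ⟨m, hm⟩ _ ⟨n, hn⟩ =>
        ⟨foataProd c (max m n), ⟨_, le_rfl⟩, hm.trans (foataProd_monotone c (le_max_left _ _)),
          hn.trans (foataProd_monotone c (le_max_right _ _))⟩ }

theorem mem_foataLimit {c : ℕ → NTraceClique G} {x : TraceMonoid G} :
    x ∈ foataLimit c ↔ ∃ n, x ≤ foataProd c n := Iff.rfl

/-- The largest clique `c` such that `x * c ≤ ξ`, for `x ≤ ξ`. -/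
noncomputable def topClique [Finite A] (x : TraceMonoid G) (ξ : GenTrace G) : TraceClique G :=
  ⟨(Set.toFinite {a | x * letter a ∈ ξ}).toFinset, by
    intro a ha b hb hab
    simp only [Set.Finite.coe_toFinset, Set.mem_ofPred_eq] at ha hb
    exact (GenTrace.mul_letter_mul_letter_mem ha hb hab).1⟩

/-! ### The greedy algorithm -/

variable [Finite A]

theorem mem_letters_topClique {x : TraceMonoid G} {ξ : GenTrace G} {a : A} :
    a ∈ (topClique x ξ).letters ↔ x * letter a ∈ ξ :=
  Set.Finite.mem_toFinset _

/-- Once a letter of `c` is appended to `x`, the other letters can still be appended, so `c` enters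
letter by letter. This is what makes `topClique` the largest clique. -/
theorem mul_toTrace_mem_iff {x : TraceMonoid G} {ξ : GenTrace G} {c : TraceClique G} :
    x * c.toTrace ∈ ξ ↔ x ∈ ξ ∧ c.letters ⊆ (topClique x ξ).letters := by
  constructor
  · refine fun h => ⟨ξ.lower (le_mul_right_self _ _) h, fun a ha => ?_⟩
    exact mem_letters_topClique.2
      (ξ.lower (mul_le_mul_left_iff.2 (letter_le_toTrace_iff.2 ha)) h)
  · rintro ⟨hx, hc⟩
    induction c using TraceClique.induction generalizing x with
    | empty => rwa [toTrace_empty, mul_one]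
    | insert a c d ha hadj hd hdt ih =>
      have hxa := mem_letters_topClique.1 (hc ((hd a).2 (.inl rfl)))
      rw [hdt, ← mul_assoc]
      refine ih hxa fun b hb => mem_letters_topClique.2 ?_
      exact (GenTrace.mul_letter_mul_letter_mem hxa
        (mem_letters_topClique.1 (hc ((hd b).2 (.inr hb)))) (hadj b hb).ne).2

theorem mul_topClique_mem {x : TraceMonoid G} {ξ : GenTrace G} (hx : x ∈ ξ) :
    x * (topClique x ξ).toTrace ∈ ξ :=
  mul_toTrace_mem_iff.2 ⟨hx, subset_rfl⟩

/-- A letter of the next clique that is independent of the whole top clique could be moved in front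
of it; it would belong to the top clique and be independent of itself. -/
theorem foata_topClique (x : TraceMonoid G) (ξ : GenTrace G) :
    (topClique x ξ).Foata (topClique (x * (topClique x ξ).toTrace) ξ) := by
  intro b hb
  by_contra! h
  rw [mem_letters_topClique, mul_assoc, ← letter_mul_toTrace_comm h, ← mul_assoc] at hb
  exact G.loopless.irrefl b
    (h b (mem_letters_topClique.2 (ξ.lower (le_mul_right_self _ _) hb)))

/-- Converse of `foata_topClique`, which recovers the past from the present: a letter available at
`x` but not in `c` would commute past `c` into the next clique, against `→`. -/
theorem topClique_eq_of_foata {x : TraceMonoid G} {ξ : GenTrace G} {c : TraceClique G}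
    (hc : x * c.toTrace ∈ ξ) (h : c.Foata (topClique (x * c.toTrace) ξ)) :
    topClique x ξ = c := by
  refine TraceClique.ext fun b => ⟨fun hb => ?_, fun hb => (mul_toTrace_mem_iff.1 hc).2 hb⟩
  obtain ⟨_, hv, ⟨u, rfl⟩, hle⟩ := ξ.directed _ hc _ (mem_letters_topClique.1 hb)
  change x * letter b ≤ x * c.toTrace * u at hle
  rw [mul_assoc, mul_le_mul_left_iff, letter_le_toTrace_mul_iff] at hle
  refine hle.resolve_right fun ⟨h1, h2⟩ => ?_
  obtain ⟨a, ha, hab⟩ :=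
    h b (mem_letters_topClique.2 (ξ.lower (mul_le_mul_left_iff.2 h2) hv))
  exact hab (h1 a ha)

/-- If no letter extends `x` within `ξ`, directedness makes `x` the greatest element of `ξ`, so that
`ξ` is a trace. -/
theorem topClique_ne_empty {x : TraceMonoid G} (ξ : TraceBoundary G) (hx : x ∈ ξ.1) :
    topClique x ξ.1 ≠ TraceClique.empty := by
  intro h
  refine ξ.2 ⟨x, le_antisymm (Order.Ideal.principal_le_iff.2 hx) fun w hw => ?_⟩
  obtain ⟨_, hv, ⟨u, rfl⟩, hwv⟩ := ξ.1.directed _ hx _ hw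
  suffices u = 1 by subst this; exact mul_one x ▸ hwv
  by_contra hu
  obtain ⟨a, ha⟩ := exists_letter_le hu
  refine TraceClique.notMem_empty (G := G) a ?_
  rw [← h, mem_letters_topClique]
  exact ξ.1.lower (mul_le_mul_left_iff.2 ha) hv

/-- Each greedy step absorbs at least one letter of `w`, as any first letter of `w` lies in the top
clique; hence `|w|` steps suffice. The base point `x` moves in the induction. -/
theorem le_foataProd_of_topClique {ξ : GenTrace G} {c : ℕ → NTraceClique G} {x w : TraceMonoid G}
    {n : ℕ} (hc : ∀ n, (c n).toClique = topClique (x * foataProd c n) ξ) (hx : x * w ∈ ξ)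
    (hn : w.length ≤ n) : w ≤ foataProd c n := by
  induction n generalizing c x w with
  | zero =>
    by_cases hw : w = 1
    · exact hw ▸ one_le' _
    · obtain ⟨a, z, rfl⟩ := exists_letter_le hw
      rw [length_mul, length_letter] at hn
      omega
  | succ n ih =>
    by_cases hw : w = 1
    · exact hw ▸ one_le' _
    have hx' : x ∈ ξ := ξ.lower (le_mul_right_self _ _) hx
    have h0 : (c 0).toClique = topClique x ξ := by
      simpa [foataProd_zero] using hc 0
    obtain ⟨_, hv, ⟨v, rfl⟩, hle⟩ := ξ.directed _ (mul_topClique_mem hx') _ hx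
    change x * w ≤ x * _ * v at hle
    rw [mul_assoc] at hv hle
    rw [mul_le_mul_left_iff] at hle
    obtain ⟨a, ha⟩ := exists_letter_le hw
    obtain ⟨u, h1, h2, -, h3⟩ := exists_le_toTrace_mul (le_mul_right_self _ v) hle
    have hlt := h3 a
      (mem_letters_topClique.2 (ξ.lower (mul_le_mul_left_iff.2 ha) hx)) ha
    rw [add_comm, foataProd_add, foataProd_succ, foataProd_zero, one_mul, h0]
    refine h1.trans (mul_le_mul_left_iff.2 ?_)
    refine ih (x := x * (topClique x ξ).toTrace) (fun i => ?_) ?_ (by omega)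
    · rw [hc (1 + i), foataProd_add, foataProd_succ, foataProd_zero, one_mul, h0, mul_assoc]
    · rw [mul_assoc]
      exact ξ.lower (mul_le_mul_left_iff.2 h2) hv

theorem foataProd_mem {ξ : GenTrace G} {c : ℕ → NTraceClique G} {n : ℕ}
    (hc : ∀ i < n, (c i).toClique = topClique (foataProd c i) ξ) : foataProd c n ∈ ξ := by
  induction n with
  | zero =>
    obtain ⟨x, hx⟩ := ξ.nonempty
    exact ξ.lower (one_le' x) hx
  | succ n ih =>
    rw [foataProd_succ, hc n n.lt_succ_self]
    exact mul_topClique_mem (ih fun i hi => hc i (hi.trans n.lt_succ_self))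

/-- The extended Cartier-Foata decomposition is given by the greedy algorithm. -/
theorem isFoataDecomp_iff {ξ : TraceBoundary G} {c : ℕ → NTraceClique G} :
    IsFoataDecomp ξ c ↔ ∀ n, (c n).toClique = topClique (foataProd c n) ξ.1 := by
  constructor
  · intro h n
    have hmem (k) : foataProd c k ∈ ξ.1 :=
      Order.Ideal.principal_le_iff.1 (h.isLUB.1 ⟨k, rfl⟩)
    have hle : ξ.1 ≤ foataLimit c := by
      refine h.isLUB.2 ?_
      rintro _ ⟨k, rfl⟩
      exact Order.Ideal.principal_le_iff.2 (mem_foataLimit.2 ⟨k, le_rfl⟩)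
    refine TraceClique.ext fun b => ⟨fun hb => ?_, fun hb => ?_⟩
    · have := hmem (n + 1)
      rw [foataProd_succ, mul_toTrace_mem_iff] at this
      exact this.2 hb
    -- The letter already occurs at a finite stage, which may be taken of the form `n + k`;
    -- cancelling the first `n` cliques makes `b` a first letter of the shifted sequence.
    · obtain ⟨k, hk⟩ := mem_foataLimit.1 (hle (mem_letters_topClique.1 hb))
      have := hk.trans (foataProd_monotone c (Nat.le_add_left k n))
      rw [foataProd_add, mul_le_mul_left_iff] at this
      exact mem_letters_of_letter_le_foataProd (fun i => h.foata (n + i)) this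
  · intro h
    refine ⟨fun i => ?_, ?_, fun η hη => ?_⟩
    · rw [h (i + 1), foataProd_succ, h i]
      exact foata_topClique _ _
    · rintro _ ⟨k, rfl⟩
      exact Order.Ideal.principal_le_iff.2 (foataProd_mem fun i _ => h i)
    · intro w hw
      have hw' : w ≤ foataProd c w.length :=
        le_foataProd_of_topClique (x := 1) (by simpa using h) (by simpa using hw) le_rfl
      exact η.lower hw' (Order.Ideal.principal_le_iff.1 (hη ⟨_, rfl⟩))

theorem exists_isFoataDecomp (ξ : TraceBoundary G) : ∃ c, IsFoataDecomp ξ c := by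
  let step : {x // x ∈ ξ.1} → {x // x ∈ ξ.1} := fun x => ⟨_, mul_topClique_mem x.2⟩
  have h1 : (1 : TraceMonoid G) ∈ ξ.1 := by
    obtain ⟨x, hx⟩ := ξ.1.nonempty
    exact ξ.1.lower (one_le' x) hx
  let s : ℕ → {x // x ∈ ξ.1} := fun n => step^[n] ⟨1, h1⟩
  let c : ℕ → NTraceClique G := fun n => ⟨topClique (s n).1 ξ.1, topClique_ne_empty ξ (s n).2⟩
  have hs (n) : foataProd c n = (s n).1 := by
    induction n with
    | zero => rfl
    | succ n ih =>
      rw [foataProd_succ, ih]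
      simp only [s, Function.iterate_succ_apply']
      rfl
  exact ⟨c, isFoataDecomp_iff.2 fun n => by rw [hs]; rfl⟩

theorem toClique_foataClique [Nonempty A] (n : ℕ) (ξ : TraceBoundary G) :
    (foataClique n ξ).toClique = topClique (foataTrace n ξ) ξ.1 :=
  isFoataDecomp_iff.1 (Classical.epsilon_spec (exists_isFoataDecomp ξ)) n

theorem foataTrace_mem [Nonempty A] (n : ℕ) (ξ : TraceBoundary G) : foataTrace n ξ ∈ ξ.1 :=
  foataProd_mem fun i _ => toClique_foataClique i ξ

/-- The infinite traces `ξ ≥ x` such that `c` is the first clique of the quotient of `ξ`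
by `x`. -/
def cliqueEvent (x : TraceMonoid G) (c : TraceClique G) : Set (TraceBoundary G) :=
  {ξ | x ∈ ξ.1 ∧ topClique x ξ.1 = c}

theorem foata_and_mem_cliqueEvent_of_foataClique_eq [Nonempty A] {c : ℕ → NTraceClique G}
    {n : ℕ} {ξ : TraceBoundary G}
    (h : ∀ i ≤ n, foataClique i ξ = c i) :
    (∀ i < n, (c i).toClique.Foata (c (i + 1)).toClique) ∧
      ξ ∈ cliqueEvent (foataProd c n) (c n).toClique := by
  have htr (i) (hi : i ≤ n) : foataTrace i ξ = foataProd c i :=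
    foataProd_congr fun j hj => h j (hj.le.trans hi)
  have hcl (i) (hi : i ≤ n) : (c i).toClique = topClique (foataProd c i) ξ.1 := by
    rw [← h i hi, toClique_foataClique, htr i hi]
  refine ⟨fun i hi => ?_, htr n le_rfl ▸ foataTrace_mem n ξ, (hcl n le_rfl).symm⟩
  rw [hcl (i + 1) hi, foataProd_succ, hcl i hi.le]
  exact foata_topClique _ _

theorem foataClique_eq_of_mem_cliqueEvent [Nonempty A] {c : ℕ → NTraceClique G} {n : ℕ}
    {ξ : TraceBoundary G} (hc : ∀ i < n, (c i).toClique.Foata (c (i + 1)).toClique)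
    (h : ξ ∈ cliqueEvent (foataProd c n) (c n).toClique) :
    ∀ i ≤ n, foataClique i ξ = c i := by
  -- The greedy cliques are identified backwards from time `n`; a forward induction then identifies
  -- them with the decomposition.
  have hdown (i) (hi : i ≤ n) : ξ ∈ cliqueEvent (foataProd c i) (c i).toClique := by
    induction hi using Nat.decreasingInduction with
    | self => exact h
    | of_succ i hi ih =>
      obtain ⟨h1, h2⟩ := ih
      rw [foataProd_succ] at h1 h2
      exact ⟨ξ.1.lower (le_mul_right_self _ _) h1,
        topClique_eq_of_foata h1 (h2 ▸ hc i hi)⟩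
  intro i
  induction i using Nat.strong_induction_on with
  | _ i ih =>
    intro hi
    refine Subtype.ext ?_
    have : foataTrace i ξ = foataProd c i :=
      foataProd_congr fun j hj => ih j hj (hj.le.trans hi)
    exact (toClique_foataClique i ξ).trans (this ▸ (hdown i hi).2)

open Classical in
theorem setOf_foataClique_eq [Nonempty A] (c : ℕ → NTraceClique G) (n : ℕ) :
    {ξ : TraceBoundary G | ∀ i ≤ n, foataClique i ξ = c i} =
      if ∀ i < n, (c i).toClique.Foata (c (i + 1)).toClique then
        cliqueEvent (foataProd c n) (c n).toClique else ∅ := by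
  ext ξ
  split_ifs with hc
  · exact ⟨fun h => (foata_and_mem_cliqueEvent_of_foataClique_eq h).2,
      foataClique_eq_of_mem_cliqueEvent hc⟩
  · exact ⟨fun h => hc (foata_and_mem_cliqueEvent_of_foataClique_eq h).1, False.elim⟩

end Foata

/-! ## Möbius inversion -/

section Mobius

variable {A : Type*} {G : SimpleGraph A} [Finite A]

open Classical in
-- Subsets of a clique are cliques, so the interval from `c` to `e` is the Boolean lattice of
-- subsets of `e \ c`, whose alternating sum vanishes unless `e = c`.
theorem TraceClique.sum_neg_one_pow_between {c e : TraceClique G} (hce : c.letters ⊆ e.letters) :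
    ∑ d : TraceClique G with c.letters ⊆ d.letters ∧ d.letters ⊆ e.letters,
      (-1 : ℝ) ^ (d.letters.card - c.letters.card) = if c = e then 1 else 0 := by
  have h : ∑ d : TraceClique G with c.letters ⊆ d.letters ∧ d.letters ⊆ e.letters,
      (-1 : ℝ) ^ (d.letters.card - c.letters.card) =
      ∑ t ∈ (e.letters \ c.letters).powerset, (-1 : ℝ) ^ t.card := by
    refine Finset.sum_bij (fun d _ => d.letters \ c.letters) ?_ ?_ ?_ ?_
    · intro d hd
      simp only [Finset.mem_filter, Finset.mem_univ, true_and] at hd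
      exact Finset.mem_powerset.2 (Finset.sdiff_subset_sdiff hd.2 subset_rfl)
    · intro d hd d' hd' h
      simp only [Finset.mem_filter, Finset.mem_univ, true_and] at hd hd'
      refine Subtype.ext ?_
      change d.letters = d'.letters
      rw [← Finset.sdiff_union_of_subset hd.1, h, Finset.sdiff_union_of_subset hd'.1]
    · intro t ht
      rw [Finset.mem_powerset] at ht
      have hsub : c.letters ∪ t ⊆ e.letters :=
        Finset.union_subset hce (ht.trans Finset.sdiff_subset)
      refine ⟨⟨c.letters ∪ t, e.2.subset (Finset.coe_subset.2 hsub)⟩, ?_, ?_⟩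
      · exact (Finset.mem_filter_univ (α := TraceClique G) _).2 ⟨Finset.subset_union_left, hsub⟩
      · exact Finset.union_sdiff_cancel_left
          (Finset.disjoint_of_subset_right ht Finset.disjoint_sdiff)
    · intro d hd
      simp only [Finset.mem_filter, Finset.mem_univ, true_and] at hd
      rw [Finset.card_sdiff_of_subset hd.1]
  have h' := congrArg (Int.cast : ℤ → ℝ)
    (Finset.sum_powerset_neg_one_pow_card (x := e.letters \ c.letters))
  rw [Int.cast_sum, Int.cast_ite, Int.cast_one, Int.cast_zero] at h'
  simp only [Int.cast_pow, Int.cast_neg, Int.cast_one] at h'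
  rw [h, h']
  refine if_congr ?_ rfl rfl
  rw [Finset.sdiff_eq_empty_iff_subset]
  exact ⟨fun h => Subtype.ext (hce.antisymm h), fun h => h ▸ subset_rfl⟩

open Classical in
/-- Möbius inversion over cliques. -/
theorem mobiusTransform_eq_of_sum {f : TraceMonoid G → ℝ} {E : TraceClique G → ℝ}
    (h : ∀ c : TraceClique G,
      f c.toTrace = ∑ e : TraceClique G with c.letters ⊆ e.letters, E e) (c : TraceClique G) :
    mobiusTransform f c = E c := by
  unfold mobiusTransform
  simp only [TraceClique.toTrace_le_toTrace_iff, TraceClique.length_toTrace, h, Finset.mul_sum]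
  rw [Finset.sum_comm' (t' := Finset.univ.filter fun e : TraceClique G => c.letters ⊆ e.letters)
    (s' := fun e => Finset.univ.filter fun d : TraceClique G =>
      c.letters ⊆ d.letters ∧ d.letters ⊆ e.letters)]
  · simp only [← Finset.sum_mul]
    rw [Finset.sum_eq_single c]
    · rw [TraceClique.sum_neg_one_pow_between subset_rfl, if_pos rfl, one_mul]
    · intro e he hec
      rw [TraceClique.sum_neg_one_pow_between (by simpa using he), if_neg hec.symm, zero_mul]
    · intro hc
      exact absurd hc (by simp)
  · intro d e
    simp only [Finset.mem_filter, Finset.mem_univ, true_and]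
    exact ⟨fun ⟨h1, h2⟩ => ⟨⟨h1, h2⟩, h1.trans h2⟩, fun h => h.1⟩

end Mobius

/-! ## Markov measures -/

section Markov

open TraceMonoid TraceClique

variable {A X : Type*} {G : SimpleGraph A}

theorem mem_elemCylinder {x : TraceMonoid G} {ξ : TraceBoundary G} :
    ξ ∈ elemCylinder x ↔ x ∈ ξ.1 :=
  Order.Ideal.principal_le_iff

theorem measurableSet_elemCylinder (x : TraceMonoid G) : MeasurableSet (elemCylinder x) :=
  have h : IsOpen (Set.Ici x.toGen) :=
    TopologicalSpace.isOpen_generateFrom_of_mem (Set.mem_union_left _ ⟨x, rfl⟩)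
  measurable_subtype_coe h.measurableSet

theorem smul_op_mul [MulAction (TraceMonoid G)ᵐᵒᵖ X] (α : X) (x y : TraceMonoid G) :
    α <• (x * y) = (α <• x) <• y := by
  rw [MulOpposite.op_mul, mul_smul]

theorem IsMarkovMeasure.isFibredValuation [MulAction (TraceMonoid G)ᵐᵒᵖ X]
    {P : X → Measure (TraceBoundary G)} (hP : IsMarkovMeasure P) :
    IsFibredValuation (markovValuation P) where
  one α := by
    have := hP.isProbabilityMeasure α
    have h : elemCylinder (1 : TraceMonoid G) = Set.univ := Set.eq_univ_of_forall fun ξ => by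
      obtain ⟨x, hx⟩ := ξ.1.nonempty
      exact mem_elemCylinder.2 (ξ.1.lower (one_le' x) hx)
    rw [markovValuation, h, probReal_univ]
  mul α x y := by
    simp only [markovValuation, measureReal_def, hP.chain, ENNReal.toReal_mul]

theorem foataTrace_succ [Nonempty A] (n : ℕ) (ξ : TraceBoundary G) :
    foataTrace (n + 1) ξ = foataTrace n ξ * (foataClique n ξ).toTrace :=
  foataProd_succ _ n

/-- There are countably many traces, so measurability and nullity can be checked at each value of
`Y_n`. -/
theorem stateClique_preimage [Nonempty A] [MulAction (TraceMonoid G)ᵐᵒᵖ X] (α : X)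
    (n : ℕ) (e : X × NTraceClique G) :
    stateClique α n ⁻¹' {e} = ⋃ (x : TraceMonoid G) (_ : α <• x = e.1),
      {ξ : TraceBoundary G | foataTrace n ξ = x ∧ foataClique n ξ = e.2} := by
  ext ξ
  simp only [Set.mem_iUnion, Set.mem_preimage, Set.mem_singleton_iff, stateClique, Prod.ext_iff,
    Set.mem_ofPred_eq]
  exact ⟨fun h => ⟨_, h.1, rfl, h.2⟩, by rintro ⟨_, h, rfl, h'⟩; exact ⟨h, h'⟩⟩

variable [Finite A]

theorem measurableSet_cliqueEvent (x : TraceMonoid G) (c : TraceClique G) :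
    MeasurableSet (cliqueEvent x c) := by
  have : cliqueEvent x c = elemCylinder x ∩ ⋂ a : A,
      {ξ | ξ ∈ elemCylinder (x * letter a) ↔ a ∈ c.letters} := by
    ext ξ
    simp only [cliqueEvent, Set.mem_inter_iff, Set.mem_iInter, Set.mem_ofPred_eq, mem_elemCylinder,
      ← mem_letters_topClique]
    exact and_congr_right fun _ => ⟨fun h => by simp [h], TraceClique.ext⟩
  rw [this]
  exact (measurableSet_elemCylinder x).inter <| MeasurableSet.iInter fun a =>
    (measurableSet_elemCylinder _).iff (.const _)

theorem measureReal_biUnion_cliqueEvent (μ : Measure (TraceBoundary G)) [IsFiniteMeasure μ]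
    (x : TraceMonoid G) {ι : Type*} {c : ι → TraceClique G} (hc : Function.Injective c)
    (s : Finset ι) :
    μ.real (⋃ i ∈ s, cliqueEvent x (c i)) = ∑ i ∈ s, μ.real (cliqueEvent x (c i)) :=
  measureReal_biUnion_finset (fun _ _ _ _ hij =>
    Set.disjoint_left.2 fun _ h1 h2 => hij (hc (h1.2.symm.trans h2.2)))
    fun _ _ => measurableSet_cliqueEvent _ _

open Classical in
theorem measureReal_elemCylinder_mul_toTrace (μ : Measure (TraceBoundary G)) [IsFiniteMeasure μ]
    (x : TraceMonoid G) (c : TraceClique G) :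
    μ.real (elemCylinder (x * c.toTrace)) =
      ∑ e : TraceClique G with c.letters ⊆ e.letters, μ.real (cliqueEvent x e) := by
  rw [← measureReal_biUnion_cliqueEvent μ x (c := fun e => e) Function.injective_id]
  congr 1
  ext ξ
  simp only [mem_elemCylinder, mul_toTrace_mem_iff, Set.mem_iUnion, Finset.mem_filter,
    Finset.mem_univ, true_and, cliqueEvent, Set.mem_ofPred_eq]
  exact ⟨fun h => ⟨_, h.2, h.1, rfl⟩, fun ⟨e, h1, h2, h3⟩ => ⟨h2, h3 ▸ h1⟩⟩

open Classical in
-- Splits according to the next greedy clique: `foata_topClique` gives one inclusion and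
-- `topClique_eq_of_foata` the other.
theorem cliqueEvent_eq_biUnion (x : TraceMonoid G) (c : TraceClique G) :
    cliqueEvent x c =
      ⋃ d ∈ Finset.univ.filter fun d : NTraceClique G => c.Foata d.toClique,
        cliqueEvent (x * c.toTrace) d.toClique := by
  ext ξ
  simp only [Set.mem_iUnion, Finset.mem_filter, Finset.mem_univ, true_and]
  constructor
  · rintro ⟨hx, rfl⟩
    exact ⟨⟨_, topClique_ne_empty ξ (mul_topClique_mem hx)⟩, foata_topClique _ _,
      mul_topClique_mem hx, rfl⟩
  · rintro ⟨d, hd, h1, h2⟩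
    exact ⟨ξ.1.lower (le_mul_right_self _ _) h1, topClique_eq_of_foata h1 (h2 ▸ hd)⟩

/-! ### Probabilities of clique events -/

variable [MulAction (TraceMonoid G)ᵐᵒᵖ X] {P : X → Measure (TraceBoundary G)}

/-- Möbius inversion is applied to `y ↦ f_α(x · y)`; the chain rule then takes `f_α(x)` out of the
sum. -/
theorem IsMarkovMeasure.measureReal_cliqueEvent (hP : IsMarkovMeasure P) (α : X)
    (x : TraceMonoid G) (c : TraceClique G) :
    (P α).real (cliqueEvent x c) =
      markovValuation P α x * mobiusTransform (markovValuation P (α <• x)) c := by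
  have := hP.isProbabilityMeasure
  rw [← mobiusTransform_eq_of_sum (f := fun y => markovValuation P α (x * y))
    (E := fun e => (P α).real (cliqueEvent x e))
    fun e => measureReal_elemCylinder_mul_toTrace (P α) x e]
  simp only [mobiusTransform, hP.isFibredValuation.mul, Finset.mul_sum]
  exact Finset.sum_congr rfl fun _ _ => by ring

theorem IsMarkovMeasure.measureReal_cliqueEvent_one (hP : IsMarkovMeasure P) (α : X)
    (c : TraceClique G) :
    (P α).real (cliqueEvent 1 c) = mobiusTransform (markovValuation P α) c := by
  rw [hP.measureReal_cliqueEvent, hP.isFibredValuation.one, one_mul, MulOpposite.op_one, one_smul]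

theorem IsMarkovMeasure.measureReal_cliqueEvent_eq_mul_foataSum (hP : IsMarkovMeasure P) (α : X)
    (x : TraceMonoid G) (c : NTraceClique G) :
    (P α).real (cliqueEvent x c.toClique) =
      markovValuation P α (x * c.toTrace) *
        foataSum (markovValuation P) (α <• (x * c.toTrace)) c := by
  have := hP.isProbabilityMeasure
  rw [cliqueEvent_eq_biUnion, measureReal_biUnion_cliqueEvent (P α) _ (c := NTraceClique.toClique)
    Subtype.val_injective]
  simp only [hP.measureReal_cliqueEvent, foataSum, Finset.mul_sum]
  rfl

theorem IsMarkovMeasure.isMobiusFibredValuation (hP : IsMarkovMeasure P) :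
    IsMobiusFibredValuation (markovValuation P) where
  toIsFibredValuation := hP.isFibredValuation
  mobius_one α := by
    have h : cliqueEvent (1 : TraceMonoid G) TraceClique.empty = ∅ :=
      Set.eq_empty_of_forall_notMem fun ξ hξ => topClique_ne_empty ξ hξ.1 hξ.2
    rw [← hP.measureReal_cliqueEvent_one, h, measureReal_empty]
  mobius_nonneg α c := by
    rw [← hP.measureReal_cliqueEvent_one]
    exact measureReal_nonneg

theorem IsMobiusFibredValuation.foataSum_nonneg {f : X → TraceMonoid G → ℝ}
    (hf : IsMobiusFibredValuation f) (α : X) (c : NTraceClique G) : 0 ≤ foataSum f α c :=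
  Finset.sum_nonneg fun _ _ => hf.mobius_nonneg _ _

theorem IsMobiusFibredValuation.mobiusTransform_eq_zero {f : X → TraceMonoid G → ℝ}
    (hf : IsMobiusFibredValuation f) {α : X} {c d : NTraceClique G} (h : foataSum f α c = 0)
    (hcd : c.toClique.Foata d.toClique) : mobiusTransform (f α) d.toClique = 0 :=
  (Finset.sum_eq_zero_iff_of_nonneg fun _ _ => hf.mobius_nonneg _ _).1 h d (by simpa using hcd)

theorem transitionMatrix_nonneg {f : X → TraceMonoid G → ℝ} (hf : IsMobiusFibredValuation f)
    (p q : X × NTraceClique G) : 0 ≤ transitionMatrix f p q := by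
  unfold transitionMatrix
  split_ifs
  exacts [le_rfl, div_nonneg (hf.mobius_nonneg _ _) (hf.foataSum_nonneg _ _), le_rfl]

theorem hasSum_transitionMatrix [Finite X] {f : X → TraceMonoid G → ℝ} {p : X × NTraceClique G}
    (hp : foataSum f (p.1 <• p.2.toTrace) p.2 ≠ 0) : HasSum (transitionMatrix f p) 1 := by
  classical
  have := Fintype.ofFinite X
  convert hasSum_fintype (transitionMatrix f p) using 1
  rw [Fintype.sum_prod_type, Finset.sum_eq_single (p.1 <• p.2.toTrace)]
  · simp only [transitionMatrix, if_neg hp, true_and]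
    rw [← Finset.sum_filter, ← Finset.sum_div, eq_comm, div_eq_one_iff_eq hp, foataSum]
  · intro β _ hβ
    exact Finset.sum_eq_zero fun γ _ => by simp [transitionMatrix, hβ]
  · simp

/-! ### The process of states and cliques -/

variable [Nonempty A]

theorem setOf_foataTrace_foataClique (n : ℕ) (x : TraceMonoid G) (c : NTraceClique G) :
    {ξ : TraceBoundary G | foataTrace n ξ = x ∧ foataClique n ξ = c} =
      {ξ | foataTrace n ξ = x} ∩ cliqueEvent x c.toClique := by
  ext ξ
  refine and_congr_right ?_
  rintro rfl
  refine ⟨?_, fun h => Subtype.ext ((toClique_foataClique n ξ).trans h.2)⟩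
  rintro rfl
  exact ⟨foataTrace_mem n ξ, (toClique_foataClique n ξ).symm⟩

theorem measurableSet_setOf_foataTrace (n : ℕ) (x : TraceMonoid G) :
    MeasurableSet {ξ : TraceBoundary G | foataTrace n ξ = x} := by
  induction n generalizing x with
  | zero => exact MeasurableSet.const (1 = x)
  | succ n ih =>
    have : {ξ : TraceBoundary G | foataTrace (n + 1) ξ = x} =
        ⋃ (y : TraceMonoid G) (c : NTraceClique G) (_ : y * c.toTrace = x),
          {ξ | foataTrace n ξ = y ∧ foataClique n ξ = c} := by
      ext ξ
      simp only [Set.mem_iUnion, Set.mem_ofPred_eq, foataTrace_succ]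
      exact ⟨fun h => ⟨_, _, h, rfl, rfl⟩, by rintro ⟨_, _, h, rfl, rfl⟩; exact h⟩
    rw [this]
    refine .iUnion fun y => .iUnion fun c => .iUnion fun _ => ?_
    rw [setOf_foataTrace_foataClique]
    exact (ih y).inter (measurableSet_cliqueEvent _ _)

theorem measurableSet_stateClique_preimage (α : X) (n : ℕ) (e : X × NTraceClique G) :
    MeasurableSet (stateClique α n ⁻¹' {e} : Set (TraceBoundary G)) := by
  rw [stateClique_preimage]
  refine .iUnion fun x => .iUnion fun _ => ?_
  rw [setOf_foataTrace_foataClique]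
  exact (measurableSet_setOf_foataTrace n x).inter (measurableSet_cliqueEvent _ _)

/-- The sum `g` is a factor of the probability of each piece of the event, so a state with a zero
row is almost surely never visited. -/
theorem IsMarkovMeasure.foataSum_ne_zero (hP : IsMarkovMeasure P) {α : X} {n : ℕ}
    {e : X × NTraceClique G} (h : P α (stateClique α n ⁻¹' {e}) ≠ 0) :
    foataSum (markovValuation P) (e.1 <• e.2.toTrace) e.2 ≠ 0 := by
  have := hP.isProbabilityMeasure
  refine fun h0 => h ?_
  rw [stateClique_preimage]
  refine measure_iUnion_null fun x => measure_iUnion_null fun hx => ?_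
  rw [setOf_foataTrace_foataClique]
  refine measure_mono_null Set.inter_subset_right ?_
  rw [← measureReal_eq_zero_iff, hP.measureReal_cliqueEvent_eq_mul_foataSum, smul_op_mul, hx, h0,
    mul_zero]

open Classical in
-- The cliques determine the states, so the conditions on states only test the consistency of `z`
-- and do not involve `ξ`.
theorem setOf_stateClique_eq (α : X) (z : ℕ → X × NTraceClique G) (n : ℕ) :
    {ξ : TraceBoundary G | ∀ i ≤ n, stateClique α i ξ = z i} =
      if (∀ i ≤ n, α <• foataProd (fun i => (z i).2) i = (z i).1) ∧
          ∀ i < n, (z i).2.toClique.Foata (z (i + 1)).2.toClique then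
        cliqueEvent (foataProd (fun i => (z i).2) n) (z n).2.toClique else ∅ := by
  have h : {ξ : TraceBoundary G | ∀ i ≤ n, stateClique α i ξ = z i} =
      {ξ | (∀ i ≤ n, α <• foataProd (fun i => (z i).2) i = (z i).1) ∧
        ∀ i ≤ n, foataClique i ξ = (z i).2} := by
    ext ξ
    simp only [Set.mem_ofPred_eq, stateClique, Prod.ext_iff, forall_and]
    refine and_congr_left fun h => forall₂_congr fun i hi => ?_
    have : foataTrace i ξ = foataProd (fun i => (z i).2) i :=
      foataProd_congr fun j hj => h j (hj.le.trans hi)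
    rw [this]
  rw [h]
  have h' := setOf_foataClique_eq (fun i => (z i).2) n
  by_cases h1 : ∀ i ≤ n, α <• foataProd (fun i => (z i).2) i = (z i).1
  · simp only [and_iff_right h1]
    exact h'
  · simp only [h1, false_and, if_false]
    exact Set.eq_empty_of_forall_notMem fun _ h => h

/-- For consistent `z`, the two probabilities share the factor `f_α(Y_{n+1})`, followed by `h` at
time `n + 1` and by `g` at time `n`. -/
theorem IsMarkovMeasure.measureReal_stateClique_succ (hP : IsMarkovMeasure P) (α : X) (n : ℕ)
    (z : ℕ → X × NTraceClique G) :
    (P α).real {ξ | ∀ i ≤ n + 1, stateClique α i ξ = z i} =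
      (P α).real {ξ | ∀ i ≤ n, stateClique α i ξ = z i} *
        transitionMatrix (markovValuation P) (z n) (z (n + 1)) := by
  classical
  rw [setOf_stateClique_eq, setOf_stateClique_eq]
  set c := fun i => (z i).2 with hc
  have hprod : foataProd c (n + 1) = foataProd c n * (z n).2.toTrace := foataProd_succ _ n
  by_cases hn : (∀ i ≤ n, α <• foataProd c i = (z i).1) ∧
      ∀ i < n, (z i).2.toClique.Foata (z (i + 1)).2.toClique
  swap
  · rw [if_neg hn, if_neg fun h => hn ⟨fun i hi => h.1 i (hi.trans n.le_succ),
      fun i hi => h.2 i (hi.trans n.lt_succ_self)⟩]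
    simp
  have hstate : α <• foataProd c (n + 1) = (z n).1 <• (z n).2.toTrace := by
    rw [hprod, smul_op_mul, hn.1 n le_rfl]
  rw [if_pos hn]
  by_cases hn' : (z (n + 1)).1 = (z n).1 <• (z n).2.toTrace ∧
      (z n).2.toClique.Foata (z (n + 1)).2.toClique
  · rw [if_pos, hP.measureReal_cliqueEvent, hP.measureReal_cliqueEvent_eq_mul_foataSum, ← hprod,
      hstate, ← hn'.1, transitionMatrix, if_pos hn']
    · split_ifs with h0
      -- When `g = 0`, the value of `h` is one of the nonnegative terms of a zero sum, so the
      -- default entry `0` is correct.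
      · rw [hP.isMobiusFibredValuation.mobiusTransform_eq_zero h0 hn'.2, mul_zero, mul_zero]
      · field_simp
    · refine ⟨fun i hi => ?_, fun i hi => ?_⟩
      · rcases Nat.le_succ_iff.1 hi with hi | rfl
        exacts [hn.1 i hi, hstate.trans hn'.1.symm]
      · rcases Nat.lt_succ_iff_lt_or_eq.1 hi with hi | rfl
        exacts [hn.2 i hi, hn'.2]
  · rw [if_neg fun h => hn' ⟨(h.1 _ le_rfl).symm.trans hstate, h.2 n n.lt_succ_self⟩,
      transitionMatrix, if_neg hn']
    simp

theorem IsMarkovMeasure.measureReal_stateClique_zero (hP : IsMarkovMeasure P) (α : X)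
    (e : X × NTraceClique G) :
    (P α).real (stateClique α 0 ⁻¹' {e}) = initialLaw (markovValuation P) α e := by
  classical
  have h : stateClique α 0 ⁻¹' {e} =
      {ξ : TraceBoundary G | ∀ i ≤ 0, stateClique α i ξ = (fun _ => e) i} := by
    ext ξ
    simp
  rw [h, setOf_stateClique_eq]
  simp only [Nat.le_zero, forall_eq, foataProd_zero, MulOpposite.op_one, one_smul, not_lt_zero,
    false_imp_iff, implies_true, and_true, initialLaw, eq_comm (a := e.1)]
  split_ifs
  · rw [hP.measureReal_cliqueEvent_one, one_mul]
  · rw [measureReal_empty, zero_mul]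

end Markov

theorem theorem1 {A X : Type*} [Finite A] [Nonempty A] (G : SimpleGraph A)
    [Finite X] [Nonempty X] [MulAction (TraceMonoid G)ᵐᵒᵖ X]
    (P : X → Measure (TraceBoundary G)) (hP : IsMarkovMeasure P) :
    IsMobiusFibredValuation (markovValuation P) ∧
    (∀ (α : X) (γ : NTraceClique G), 0 ≤ foataSum (markovValuation P) α γ) ∧
    ∀ α₀ : X, IsHomogeneousMarkovChain (P α₀) (stateClique α₀)
      (initialLaw (markovValuation P) α₀) (transitionMatrix (markovValuation P)) := by
  have hM := hP.isMobiusFibredValuation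
  refine ⟨hM, hM.foataSum_nonneg, fun α₀ => ?_⟩
  exact
    { measurable := measurableSet_stateClique_preimage α₀
      init := hP.measureReal_stateClique_zero α₀
      nonneg := transitionMatrix_nonneg hM
      hasSum := fun n e h => hasSum_transitionMatrix (hP.foataSum_ne_zero h)
      step := hP.measureReal_stateClique_succ α₀ }
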